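/- Let $\mathbb D$ be the open unit disk, $\mathbb T$ the unit circle, and $m$ the normalized arc length measure on $\mathbb T$. Let $\varphi$ be a nonconstant bounded holomorphic function on $\mathbb D$ with $\|\varphi\|_\infty=\sup_{z\in\mathbb D}|\varphi(z)|=1$. One says that $\varphi$ has an angular derivative at $\zeta\in\mathbb T$ if $\varphi$ and $\varphi'$ both have (finite) nontangential limits $\varphi(\zeta)$ and $\varphi'(\zeta)$ at $\zeta$ and $|\varphi(\zeta)|=1$. Let $\mathcal E\subset\mathbb T$ be a Lebesgue measurable set such that $\varphi$ has an angular derivative $\varphi'(\zeta)$ at almost every $\zeta\in\mathcal E$, and assume that $\log|\varphi'|\in L^1(\mathcal E,m)$. Put $h=|\varphi'|\chi_{\mathcal E}+\chi_{\mathbb T\setminus\mathcal E}$, let $$\mathcal O(z)=\exp\left\{\int_{\mathbb T}\frac{\zeta+z}{\zeta-z}\,\log h(\zeta)\,dm(\zeta)\right\},\qquad z\in\mathbb D,$$ be the outer function with modulus $h$, and for $z\in\mathbb D$ let $\omega_z$ be the harmonic measure on $\mathbb T$ given by $d\omega_z(\zeta)=\frac{1-|z|^2}{|\zeta-z|^2}\,dm(\zeta)$.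 Then, for every $z\in\mathbb D$, $$\frac{1-|\varphi(z)|^2}{1-|z|^2}\le|\mathcal O(z)|\left\{\frac1{1-\omega_z(\mathcal E)}\cdot\frac{1+|z|}{1-|z|}\right\}^{1-\omega_z(\mathcal E)},$$ where the factor $\{\cdots\}^{1-\omega_z(\mathcal E)}$ is understood as $1$ when $\omega_z(\mathcal E)=1$. -/

import Mathlib

open MeasureTheory Filter Topology Set

noncomputable section

/-- The unit circle carries its Borel σ-algebra. -/
instance instMeasurableSpaceCircle : MeasurableSpace Circle := borel Circle

instance instBorelSpaceCircle : BorelSpace Circle := ⟨rfl⟩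

/-- Normalized arc length on the unit circle: the image of `dθ / (2π)` on `(0, 2π]` under
`θ ↦ e^{iθ}`. -/
def circleMeasure : Measure Circle :=
  ENNReal.ofReal (2 * Real.pi)⁻¹ •
    (volume.restrict (Ioc (0 : ℝ) (2 * Real.pi))).map (fun θ : ℝ => Circle.exp θ)

/-- The nontangential approach region (Stolz angle) of aperture `α` in the unit disk
at the point `ζ` of the unit circle. -/
def stolzRegion (ζ : Circle) (α : ℝ) : Set ℂ :=
  {z : ℂ | ‖z‖ < 1 ∧ ‖(ζ : ℂ) - z‖ < α * (1 - ‖z‖)}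

/-- The function `f` on the unit disk has the nontangential limit `L` at `ζ`. -/
def HasNontangentialLimit (f : ℂ → ℂ) (ζ : Circle) (L : ℂ) : Prop :=
  ∀ α : ℝ, 1 < α → Tendsto f (𝓝[stolzRegion ζ α] (ζ : ℂ)) (𝓝 L)

/-- The function `φ` on the unit disk has the angular derivative `d` at `ζ`, in the sense of
Carathéodory: `φ` and `φ'` have nontangential limits at `ζ`, the former of modulus one
and the latter equal to `d`. -/
def HasAngularDerivAt (φ : ℂ → ℂ) (ζ : Circle) (d : ℂ) : Prop :=
  (∃ η : ℂ, ‖η‖ = 1 ∧ HasNontangentialLimit φ ζ η) ∧ HasNontangentialLimit (deriv φ) ζ d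

open Classical in
/-- The angular derivative `φ'(ζ)` at a point `ζ` of the unit circle where it exists
(the value elsewhere is irrelevant). -/
def angularDeriv (φ : ℂ → ℂ) (ζ : Circle) : ℂ :=
  if h : ∃ d : ℂ, HasAngularDerivAt φ ζ d then h.choose else 0

/-- Harmonic measure on the unit circle associated with the point `z` of the unit disk:
the measure with density `(1 - |z|²) / |ζ - z|²` with respect to normalized arc length. -/
def harmonicMeasure (z : ℂ) : Measure Circle :=
  circleMeasure.withDensity
    (fun ζ : Circle => ENNReal.ofReal ((1 - ‖z‖ ^ 2) / ‖(ζ : ℂ) - z‖ ^ 2))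

/-- The outer function with modulus `h`, for `h` nonnegative with `log h` integrable
on the unit circle. -/
def outerFunction (h : Circle → ℝ) (z : ℂ) : ℂ :=
  Complex.exp (∫ ζ : Circle,
    (((ζ : ℂ) + z) / ((ζ : ℂ) - z)) * ((Real.log (h ζ) : ℝ) : ℂ) ∂circleMeasure)

end

noncomputable section

open Metric ComplexConjugate

/-! Write `a = φ z`, `q = ω_z(Eᶜ)` and `P` for the Poisson density at `z`. The function `log ‖1 -
conj a * φ‖` is harmonic with value `log (1 - ‖a‖²)` at `z`. Doubled and averaged over the circle,
it splits into two pieces. On `Eᶜ`, Jensen's inequality bounds the piece by `q log ((1 - ‖a‖²) /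
q)`, since `‖1 - conj a * φ‖² ≤ 1 - 2 Re (conj a * φ) + ‖a‖²`, whose value at `z` is `1 - ‖a‖²`
(`two_mul_log_one_sub_norm_sq_le`). On `E`, `julia_inequality` gives `P ‖1 - conj a * φ‖² ≤ (1 -
‖a‖²) ‖φ'‖`. Integrating logarithms leaves `-∫_E log P`, which equals `log (1 - ‖z‖²) + ∫_Eᶜ log P`
by `integral_log_poissonDensity`; there `P ≤ (1 + ‖z‖) / (1 - ‖z‖)`. Adding up, one copy of `log (1
- ‖a‖²)` cancels and the logarithm of the claim remains. -/

/-! ### Disk automorphisms and Schwarz–Pick. -/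

theorem norm_one_sub_conj_mul_sq_sub (a b : ℂ) :
    ‖1 - conj a * b‖ ^ 2 - ‖a - b‖ ^ 2 = (1 - ‖a‖ ^ 2) * (1 - ‖b‖ ^ 2) := by
  simp only [← Complex.normSq_eq_norm_sq, Complex.normSq_apply, Complex.sub_re, Complex.sub_im,
    Complex.mul_re, Complex.mul_im, Complex.conj_re, Complex.conj_im, Complex.one_re,
    Complex.one_im]
  ring

theorem norm_one_sub_conj_mul_circle (z : ℂ) (ζ : Circle) :
    ‖1 - conj z * ζ‖ = ‖(ζ : ℂ) - z‖ := by
  have h := norm_one_sub_conj_mul_sq_sub z ζ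
  rw [Circle.norm_coe, one_pow, sub_self, mul_zero, sub_eq_zero] at h
  rw [norm_sub_rev (ζ : ℂ)]
  exact (sq_eq_sq₀ (norm_nonneg _) (norm_nonneg _)).1 h

/-- Keeps `1 - conj a * b` in the slit plane, so that its principal logarithm is holomorphic. -/
theorem re_one_sub_conj_mul_pos {a b : ℂ} (ha : ‖a‖ < 1) (hb : ‖b‖ ≤ 1) :
    0 < (1 - conj a * b).re := by
  have h : ‖conj a * b‖ < 1 := by
    rw [norm_mul, RCLike.norm_conj]
    nlinarith [norm_nonneg a, norm_nonneg b]
  have := Complex.re_le_norm (conj a * b)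
  simp only [Complex.sub_re, Complex.one_re]
  linarith

theorem one_sub_conj_mul_ne_zero {a b : ℂ} (ha : ‖a‖ < 1) (hb : ‖b‖ ≤ 1) :
    1 - conj a * b ≠ 0 := fun h => by
  have := re_one_sub_conj_mul_pos ha hb
  simp [h] at this

/-- The involutive automorphism of the unit disk exchanging `0` and `a`. -/
def diskAut (a w : ℂ) : ℂ := (a - w) / (1 - conj a * w)

theorem mapsTo_diskAut {a : ℂ} (ha : ‖a‖ < 1) :
    MapsTo (diskAut a) (ball 0 1) (ball 0 1) := fun w hw => by
  rw [mem_ball_zero_iff] at hw ⊢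
  have h0 := norm_pos_iff.2 (one_sub_conj_mul_ne_zero ha hw.le)
  rw [diskAut, norm_div, div_lt_one h0]
  refine lt_of_pow_lt_pow_left₀ 2 h0.le (sub_pos.1 ?_)
  rw [norm_one_sub_conj_mul_sq_sub]
  have := norm_nonneg a
  have := norm_nonneg w
  exact mul_pos (by nlinarith) (by nlinarith)

theorem differentiableOn_diskAut {a : ℂ} (ha : ‖a‖ < 1) :
    DifferentiableOn ℂ (diskAut a) (ball 0 1) := by
  refine DifferentiableOn.div (by fun_prop) (by fun_prop) fun w hw => ?_
  exact one_sub_conj_mul_ne_zero ha (mem_ball_zero_iff.1 hw).le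

theorem diskAut_diskAut {a w : ℂ} (ha : ‖a‖ < 1) (hw : ‖w‖ < 1) :
    diskAut a (diskAut a w) = w := by
  have h0 := one_sub_conj_mul_ne_zero ha hw.le
  have h1 := one_sub_conj_mul_ne_zero ha ha.le
  have h2 : (1 - conj a * w) - conj a * (a - w) ≠ 0 := by
    convert h1 using 1; ring
  rw [diskAut, diskAut]
  have e : 1 - conj a * ((a - w) / (1 - conj a * w)) =
      ((1 - conj a * w) - conj a * (a - w)) / (1 - conj a * w) := by
    field_simp
  have e' : a - (a - w) / (1 - conj a * w) =
      (w * ((1 - conj a * w) - conj a * (a - w))) / (1 - conj a * w) := by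
    rw [eq_div_iff h0, sub_mul, div_mul_cancel₀ _ h0]; ring
  rw [e, e', div_div_div_cancel_right₀ h0, mul_div_assoc, div_self h2, mul_one]

theorem diskAut_zero (a : ℂ) : diskAut a 0 = a := by simp [diskAut]

theorem diskAut_self (a : ℂ) : diskAut a a = 0 := by simp [diskAut]

/-- Conjugating `φ` by the involutions at `z` and `φ z` gives a self-map fixing `0`, to which the
Schwarz lemma applies. -/
theorem norm_diskAut_le_of_mapsTo_ball {φ : ℂ → ℂ} (hφ : DifferentiableOn ℂ φ (ball 0 1))
    (hm : MapsTo φ (ball 0 1) (ball 0 1)) {z w : ℂ} (hz : ‖z‖ < 1) (hw : ‖w‖ < 1) :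
    ‖diskAut (φ z) (φ w)‖ ≤ ‖diskAut z w‖ := by
  have ha : ‖φ z‖ < 1 := mem_ball_zero_iff.1 (hm (mem_ball_zero_iff.2 hz))
  have hd : DifferentiableOn ℂ (diskAut (φ z) ∘ φ ∘ diskAut z) (ball 0 1) :=
    (differentiableOn_diskAut ha).comp (hφ.comp (differentiableOn_diskAut hz) (mapsTo_diskAut hz))
      (hm.comp (mapsTo_diskAut hz))
  have hmm : MapsTo (diskAut (φ z) ∘ φ ∘ diskAut z) (ball 0 1) (ball 0 1) :=
    (mapsTo_diskAut ha).comp (hm.comp (mapsTo_diskAut hz))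
  have h := Complex.norm_le_norm_of_mapsTo_ball hd (hmm.mono_right ball_subset_closedBall)
    (by simp [diskAut_zero, diskAut_self])
    (mem_ball_zero_iff.1 (mapsTo_diskAut hz (mem_ball_zero_iff.2 hw)))
  simpa [diskAut_diskAut hz hw] using h

/-- The Schwarz–Pick inequality, in terms of pseudohyperbolic defects. -/
theorem schwarz_pick {φ : ℂ → ℂ} (hφ : DifferentiableOn ℂ φ (ball 0 1))
    (hm : MapsTo φ (ball 0 1) (ball 0 1)) {z w : ℂ} (hz : ‖z‖ < 1) (hw : ‖w‖ < 1) :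
    (1 - ‖z‖ ^ 2) * (1 - ‖w‖ ^ 2) * ‖1 - conj (φ z) * φ w‖ ^ 2 ≤
      (1 - ‖φ z‖ ^ 2) * (1 - ‖φ w‖ ^ 2) * ‖1 - conj z * w‖ ^ 2 := by
  have ha : ‖φ z‖ < 1 := mem_ball_zero_iff.1 (hm (mem_ball_zero_iff.2 hz))
  have hb : ‖φ w‖ < 1 := mem_ball_zero_iff.1 (hm (mem_ball_zero_iff.2 hw))
  have h := norm_diskAut_le_of_mapsTo_ball hφ hm hz hw
  have h1 := norm_pos_iff.2 (one_sub_conj_mul_ne_zero ha hb.le)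
  have h2 := norm_pos_iff.2 (one_sub_conj_mul_ne_zero hz hw.le)
  rw [diskAut, diskAut, norm_div, norm_div, div_le_div_iff₀ h1 h2] at h
  have h3 := pow_le_pow_left₀ (by positivity) h 2
  rw [← norm_one_sub_conj_mul_sq_sub, ← norm_one_sub_conj_mul_sq_sub]
  nlinarith

theorem norm_lt_one_of_isLUB {φ : ℂ → ℂ} (hφ : DifferentiableOn ℂ φ (ball 0 1))
    (hle : ∀ z ∈ ball (0 : ℂ) 1, ‖φ z‖ ≤ 1)
    (hnc : ¬ ∃ c : ℂ, ∀ z ∈ ball (0 : ℂ) 1, φ z = c) :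
    MapsTo φ (ball 0 1) (ball 0 1) := fun z hz => by
  rw [mem_ball_zero_iff]
  refine lt_of_le_of_ne (hle z hz) fun h => hnc ⟨φ z, ?_⟩
  exact Complex.eqOn_of_isPreconnected_of_isMaxOn_norm (convex_ball 0 1).isPreconnected
    isOpen_ball hφ hz fun w hw => by simpa [h] using hle w hw

/-! ### Radial approach to a boundary point -/

theorem norm_ofReal_mul_circle {r : ℝ} (hr : 0 ≤ r) (ζ : Circle) : ‖(r : ℂ) * ζ‖ = r := by
  rw [norm_mul, Circle.norm_coe, mul_one, Complex.norm_real, Real.norm_of_nonneg hr]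

theorem tendsto_radius_nhdsWithin_stolzRegion (ζ : Circle) {α : ℝ} (hα : 1 < α) :
    Tendsto (fun r : ℝ => (r : ℂ) * ζ) (𝓝[<] 1) (𝓝[stolzRegion ζ α] (ζ : ℂ)) := by
  refine tendsto_nhdsWithin_iff.2 ⟨?_, ?_⟩
  · have h := (by fun_prop : Continuous fun r : ℝ => (r : ℂ) * ζ).tendsto 1
    rw [Complex.ofReal_one, one_mul] at h
    exact h.mono_left nhdsWithin_le_nhds
  · filter_upwards [Ioo_mem_nhdsLT (zero_lt_one' ℝ)] with r hr
    have h1 : ‖(ζ : ℂ) - r * ζ‖ = 1 - r := by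
      rw [show (ζ : ℂ) - r * ζ = ((1 - r : ℝ) : ℂ) * ζ by push_cast; ring,
        norm_ofReal_mul_circle (by linarith [hr.2])]
    refine ⟨by rw [norm_ofReal_mul_circle hr.1.le]; exact hr.2, ?_⟩
    rw [h1, norm_ofReal_mul_circle hr.1.le]
    nlinarith [hr.2]

theorem HasNontangentialLimit.tendsto_radius {f : ℂ → ℂ} {ζ : Circle} {L : ℂ}
    (h : HasNontangentialLimit f ζ L) :
    Tendsto (fun r : ℝ => f ((r : ℂ) * ζ)) (𝓝[<] 1) (𝓝 L) :=
  (h 2 one_lt_two).comp (tendsto_radius_nhdsWithin_stolzRegion ζ one_lt_two)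

/-- Mean value inequality on the radial segment from `r` to `s`, followed by `s → 1`. The slack `‖d‖
< C` makes the bound on `deriv φ` hold near the endpoint. -/
theorem eventually_norm_sub_le_of_tendsto_deriv {φ : ℂ → ℂ}
    (hφ : DifferentiableOn ℂ φ (ball 0 1)) {ζ : Circle} {η d : ℂ}
    (hη : HasNontangentialLimit φ ζ η) (hd : HasNontangentialLimit (deriv φ) ζ d)
    {C : ℝ} (hC : ‖d‖ < C) :
    ∀ᶠ r : ℝ in 𝓝[<] 1, ‖η - φ ((r : ℂ) * ζ)‖ ≤ C * (1 - r) := by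
  have h1 : ∀ᶠ r : ℝ in 𝓝[<] 1, ‖deriv φ ((r : ℂ) * ζ)‖ < C :=
    hd.tendsto_radius.norm.eventually_lt_const hC
  obtain ⟨l, hl, hl'⟩ := (mem_nhdsLT_iff_exists_Ioo_subset).1 h1
  filter_upwards [Ioo_mem_nhdsLT (zero_lt_one' ℝ), Ioo_mem_nhdsLT hl] with r hr hr'
  have h2 : ∀ᶠ s : ℝ in 𝓝[<] 1, ‖φ ((s : ℂ) * ζ) - φ ((r : ℂ) * ζ)‖ ≤ C * (s - r) := by
    filter_upwards [Ioo_mem_nhdsLT hr.2] with s hs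
    have hder : ∀ x ∈ Icc r s, HasDerivWithinAt (fun x : ℝ => φ ((x : ℂ) * ζ))
        (deriv φ ((x : ℂ) * ζ) * ζ) (Icc r s) x := fun x hx => by
      have hx0 : 0 ≤ x := hr.1.le.trans hx.1
      have hmem : (x : ℂ) * ζ ∈ ball (0 : ℂ) 1 := by
        rw [mem_ball_zero_iff, norm_ofReal_mul_circle hx0]
        exact hx.2.trans_lt hs.2
      have hA := (hφ.differentiableAt (isOpen_ball.mem_nhds hmem)).hasDerivAt
      have hB : HasDerivAt (fun x : ℝ => (x : ℂ) * ζ) (ζ : ℂ) x := by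
        simpa using (Complex.ofRealCLM.hasDerivAt (x := x)).mul_const (ζ : ℂ)
      exact (hA.comp x hB).hasDerivWithinAt
    refine norm_image_sub_le_of_norm_deriv_le_segment' hder (fun x hx => ?_) s
      (right_mem_Icc.2 hs.1.le)
    rw [norm_mul, Circle.norm_coe, mul_one]
    exact (hl' ⟨hr'.1.trans_le hx.1, hx.2.trans hs.2⟩ : _ < C).le
  have h3 : Tendsto (fun s : ℝ => C * (s - r)) (𝓝[<] 1) (𝓝 (C * (1 - r))) :=
    ((by fun_prop : Continuous fun s : ℝ => C * (s - r)).tendsto 1).mono_left nhdsWithin_le_nhds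
  exact le_of_tendsto_of_tendsto (hη.tendsto_radius.sub_const _).norm h3 h2

/-- Julia's inequality at a point with an angular derivative. -/
theorem julia_inequality {φ : ℂ → ℂ} (hφ : DifferentiableOn ℂ φ (ball 0 1))
    (hm : MapsTo φ (ball 0 1) (ball 0 1)) {ζ : Circle} {η d : ℂ} (hη1 : ‖η‖ = 1)
    (hη : HasNontangentialLimit φ ζ η) (hd : HasNontangentialLimit (deriv φ) ζ d)
    {z : ℂ} (hz : ‖z‖ < 1) :
    (1 - ‖z‖ ^ 2) * ‖1 - conj (φ z) * η‖ ^ 2 ≤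
      (1 - ‖φ z‖ ^ 2) * ‖d‖ * ‖(ζ : ℂ) - z‖ ^ 2 := by
  have ha : ‖φ z‖ < 1 := mem_ball_zero_iff.1 (hm (mem_ball_zero_iff.2 hz))
  have ha2 : 0 ≤ 1 - ‖φ z‖ ^ 2 := by nlinarith [norm_nonneg (φ z)]
  have hζ := norm_one_sub_conj_mul_circle z ζ
  suffices H : ∀ C, ‖d‖ < C → (1 - ‖z‖ ^ 2) * ‖1 - conj (φ z) * η‖ ^ 2 ≤
      (1 - ‖φ z‖ ^ 2) * C * ‖(ζ : ℂ) - z‖ ^ 2 by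
    have h1 : Tendsto (fun C : ℝ => (1 - ‖φ z‖ ^ 2) * C * ‖(ζ : ℂ) - z‖ ^ 2) (𝓝[>] ‖d‖)
        (𝓝 ((1 - ‖φ z‖ ^ 2) * ‖d‖ * ‖(ζ : ℂ) - z‖ ^ 2)) :=
      ((by fun_prop : Continuous fun C : ℝ =>
        (1 - ‖φ z‖ ^ 2) * C * ‖(ζ : ℂ) - z‖ ^ 2).tendsto _).mono_left nhdsWithin_le_nhds
    exact ge_of_tendsto h1 (eventually_nhdsWithin_of_forall H)
  intro C hC
  have hC0 : 0 ≤ C := (norm_nonneg d).trans hC.le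
  -- Schwarz–Pick at `w = r ζ` with the common factor `1 - r` cancelled; as `r → 1` the factor `1 +
  -- r` absorbs the `2` of `2 * C`.
  have key : ∀ᶠ r : ℝ in 𝓝[<] 1,
      (1 - ‖z‖ ^ 2) * (1 + r) * ‖1 - conj (φ z) * φ ((r : ℂ) * ζ)‖ ^ 2 ≤
        (1 - ‖φ z‖ ^ 2) * (2 * C) * ‖1 - conj z * ((r : ℂ) * ζ)‖ ^ 2 := by
    filter_upwards [Ioo_mem_nhdsLT (zero_lt_one' ℝ),
      eventually_norm_sub_le_of_tendsto_deriv hφ hη hd hC] with r hr h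
    have hw : ‖(r : ℂ) * ζ‖ < 1 := by rw [norm_ofReal_mul_circle hr.1.le]; exact hr.2
    have hb : ‖φ ((r : ℂ) * ζ)‖ < 1 := mem_ball_zero_iff.1 (hm (mem_ball_zero_iff.2 hw))
    have hsp := schwarz_pick hφ hm hz hw
    rw [norm_ofReal_mul_circle hr.1.le] at hsp
    have h4 : 1 - ‖φ ((r : ℂ) * ζ)‖ ^ 2 ≤ 2 * C * (1 - r) := by
      have := norm_sub_norm_le η (φ ((r : ℂ) * ζ))
      rw [hη1] at this
      nlinarith [norm_nonneg (φ ((r : ℂ) * ζ))]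
    have h5 := mul_le_mul_of_nonneg_right (mul_le_mul_of_nonneg_left h4 ha2)
      (sq_nonneg ‖1 - conj z * ((r : ℂ) * ζ)‖)
    have h6 := hsp.trans h5
    refine le_of_mul_le_mul_right ?_ (sub_pos.2 hr.2)
    linarith
  have hr1 : Tendsto (fun r : ℝ => 1 + r) (𝓝[<] 1) (𝓝 (1 + 1)) :=
    ((by fun_prop : Continuous fun r : ℝ => 1 + r).tendsto _).mono_left nhdsWithin_le_nhds
  have hr2 : Tendsto (fun r : ℝ => ‖1 - conj z * ((r : ℂ) * ζ)‖ ^ 2) (𝓝[<] 1)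
      (𝓝 (‖(ζ : ℂ) - z‖ ^ 2)) := by
    have h := ((by fun_prop : Continuous fun r : ℝ =>
      ‖1 - conj z * ((r : ℂ) * ζ)‖ ^ 2).tendsto 1).mono_left (nhdsWithin_le_nhds (s := Iio 1))
    rwa [Complex.ofReal_one, one_mul, hζ] at h
  have hL := (hr1.const_mul (1 - ‖z‖ ^ 2)).mul
    (((hη.tendsto_radius.const_mul (conj (φ z))).const_sub 1).norm.pow 2)
  have := le_of_tendsto_of_tendsto hL (hr2.const_mul ((1 - ‖φ z‖ ^ 2) * (2 * C))) key
  linarith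

/-! ### Harmonic measure and the Poisson integral -/

/-- The density of harmonic measure with respect to normalized arc length. -/
def poissonDensity (z : ℂ) (ζ : Circle) : ℝ := (1 - ‖z‖ ^ 2) / ‖(ζ : ℂ) - z‖ ^ 2

theorem norm_circle_sub_pos {z : ℂ} (hz : ‖z‖ < 1) (ζ : Circle) : 0 < ‖(ζ : ℂ) - z‖ := by
  have := norm_sub_norm_le (ζ : ℂ) z
  rw [Circle.norm_coe] at this
  linarith

theorem one_sub_norm_sq_pos {z : ℂ} (hz : ‖z‖ < 1) : 0 < 1 - ‖z‖ ^ 2 := by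
  nlinarith [norm_nonneg z]

theorem poissonDensity_pos {z : ℂ} (hz : ‖z‖ < 1) (ζ : Circle) : 0 < poissonDensity z ζ :=
  div_pos (one_sub_norm_sq_pos hz) (pow_pos (norm_circle_sub_pos hz ζ) 2)

theorem continuous_poissonDensity {z : ℂ} (hz : ‖z‖ < 1) : Continuous (poissonDensity z) :=
  Continuous.div (by fun_prop) (by fun_prop) fun ζ => (pow_pos (norm_circle_sub_pos hz ζ) 2).ne'

theorem poissonDensity_le {z : ℂ} (hz : ‖z‖ < 1) (ζ : Circle) :
    poissonDensity z ζ ≤ (1 + ‖z‖) / (1 - ‖z‖) := by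
  have h1 : 0 < 1 - ‖z‖ := by linarith
  have h2 := norm_sub_norm_le (ζ : ℂ) z
  rw [Circle.norm_coe] at h2
  rw [poissonDensity, div_le_div_iff₀ (pow_pos (norm_circle_sub_pos hz ζ) 2) h1]
  have h3 : (1 - ‖z‖) ^ 2 ≤ ‖(ζ : ℂ) - z‖ ^ 2 := pow_le_pow_left₀ h1.le h2 2
  nlinarith [mul_le_mul_of_nonneg_left h3 (by positivity : 0 ≤ 1 + ‖z‖)]

theorem integral_circleMeasure {F : Type*} [NormedAddCommGroup F] [NormedSpace ℝ F]
    {f : Circle → F} (hf : Continuous f) :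
    ∫ ζ, f ζ ∂circleMeasure = (2 * Real.pi)⁻¹ • ∫ θ in (0 : ℝ)..2 * Real.pi, f (Circle.exp θ) := by
  have hm : Measurable fun θ : ℝ => Circle.exp θ := Circle.exp.continuous.measurable
  rw [circleMeasure, integral_smul_measure, integral_map hm.aemeasurable
    hf.aestronglyMeasurable, intervalIntegral.integral_of_le Real.two_pi_pos.le,
    ENNReal.toReal_ofReal (by positivity)]

theorem harmonicMeasure_def (z : ℂ) : harmonicMeasure z =
    circleMeasure.withDensity fun ζ => ENNReal.ofReal (poissonDensity z ζ) := rfl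

theorem measurable_ofReal_poissonDensity {z : ℂ} (hz : ‖z‖ < 1) :
    Measurable fun ζ => ENNReal.ofReal (poissonDensity z ζ) :=
  (continuous_poissonDensity hz).measurable.ennreal_ofReal

theorem integral_harmonicMeasure {F : Type*} [NormedAddCommGroup F] [NormedSpace ℝ F]
    {z : ℂ} (hz : ‖z‖ < 1) (f : Circle → F) :
    ∫ ζ, f ζ ∂harmonicMeasure z = ∫ ζ, poissonDensity z ζ • f ζ ∂circleMeasure := by
  rw [harmonicMeasure_def, integral_withDensity_eq_integral_toReal_smul
    (measurable_ofReal_poissonDensity hz) (.of_forall fun _ => ENNReal.ofReal_lt_top)]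
  simp_rw [ENNReal.toReal_ofReal (poissonDensity_pos hz _).le]

theorem integrable_harmonicMeasure {F : Type*} [NormedAddCommGroup F] [NormedSpace ℝ F]
    {z : ℂ} (hz : ‖z‖ < 1) {f : Circle → F} (hf : Integrable f circleMeasure) :
    Integrable f (harmonicMeasure z) := by
  rw [harmonicMeasure_def, integrable_withDensity_iff_integrable_smul'
    (measurable_ofReal_poissonDensity hz) (.of_forall fun _ => ENNReal.ofReal_lt_top)]
  refine hf.bdd_smul ((1 + ‖z‖) / (1 - ‖z‖))
    (measurable_ofReal_poissonDensity hz).ennreal_toReal.aestronglyMeasurable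
    (.of_forall fun ζ => ?_)
  rw [ENNReal.toReal_ofReal (poissonDensity_pos hz _).le,
    Real.norm_of_nonneg (poissonDensity_pos hz _).le]
  exact poissonDensity_le hz ζ

theorem harmonicMeasure_absolutelyContinuous (z : ℂ) : harmonicMeasure z ≪ circleMeasure :=
  withDensity_absolutelyContinuous _ _

theorem DiffContOnCl.continuous_comp_circle {f : ℂ → ℂ} (hf : DiffContOnCl ℂ f (ball 0 1)) :
    Continuous fun ζ : Circle => f ζ :=
  (closure_ball (0 : ℂ) one_ne_zero ▸ hf.continuousOn).comp_continuous
    (by fun_prop : Continuous fun ζ : Circle => (ζ : ℂ))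
    fun ζ => mem_closedBall_zero_iff.2 (Circle.norm_coe ζ).le

/-- The Poisson integral formula against harmonic measure. -/
theorem integral_harmonicMeasure_of_diffContOnCl {z : ℂ} (hz : ‖z‖ < 1) {f : ℂ → ℂ}
    (hf : DiffContOnCl ℂ f (ball 0 1)) : ∫ ζ : Circle, f ζ ∂harmonicMeasure z = f z := by
  have hfc := hf.continuous_comp_circle
  rw [integral_harmonicMeasure hz, integral_circleMeasure (f := fun ζ => poissonDensity z ζ • f ζ)
    ((continuous_poissonDensity hz).smul hfc),
    ← hf.circleAverage_poissonKernel_smul' (mem_ball_zero_iff.2 hz), Real.circleAverage]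
  congr 2 with θ
  simp [poissonDensity, circleMap, Circle.coe_exp, Complex.norm_exp_ofReal_mul_I]

theorem isProbabilityMeasure_harmonicMeasure {z : ℂ} (hz : ‖z‖ < 1) :
    IsProbabilityMeasure (harmonicMeasure z) := by
  have h := integral_harmonicMeasure_of_diffContOnCl hz (f := fun _ => 1) diffContOnCl_const
  rw [integral_const, Measure.real] at h
  constructor
  have h1 : (harmonicMeasure z univ).toReal = 1 := by simpa using h
  exact (ENNReal.toReal_eq_one_iff _).1 h1

theorem integrable_harmonicMeasure_of_continuous {F : Type*} [NormedAddCommGroup F]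
    [NormedSpace ℝ F] [SecondCountableTopology F]
    {z : ℂ} (hz : ‖z‖ < 1) {f : Circle → F} (hf : Continuous f) :
    Integrable f (harmonicMeasure z) := by
  have := isProbabilityMeasure_harmonicMeasure hz
  exact hf.integrable_of_hasCompactSupport (HasCompactSupport.of_compactSpace f)

/-- `log ‖g‖` is the real part of the holomorphic function `log g`. -/
theorem integral_log_norm_harmonicMeasure {z : ℂ} (hz : ‖z‖ < 1) {g : ℂ → ℂ}
    (hg : DiffContOnCl ℂ g (ball 0 1)) (hre : ∀ w ∈ closedBall (0 : ℂ) 1, 0 < (g w).re) :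
    ∫ ζ : Circle, Real.log ‖g ζ‖ ∂harmonicMeasure z = Real.log ‖g z‖ := by
  have hs : ∀ w ∈ closedBall (0 : ℂ) 1, g w ∈ Complex.slitPlane := fun w hw => .inl (hre w hw)
  have hcl := closure_ball (0 : ℂ) one_ne_zero
  have hgc : ContinuousOn (fun w => Complex.log (g w)) (closedBall 0 1) :=
    (hcl ▸ hg.continuousOn).clog hs
  have hd : DiffContOnCl ℂ (fun w => Complex.log (g w)) (ball 0 1) :=
    ⟨hg.differentiableOn.clog fun w hw => hs w (ball_subset_closedBall hw), by rwa [hcl]⟩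
  have h := congrArg Complex.re (integral_harmonicMeasure_of_diffContOnCl hz hd)
  have hi : Integrable (fun ζ : Circle => Complex.log (g ζ)) (harmonicMeasure z) :=
    integrable_harmonicMeasure_of_continuous hz
      (hgc.comp_continuous (by fun_prop : Continuous fun ζ : Circle => (ζ : ℂ))
        fun ζ => mem_closedBall_zero_iff.2 (Circle.norm_coe ζ).le)
  have h2 := Complex.reCLM.integral_comp_comm hi
  simp only [Complex.reCLM_apply, Complex.log_re] at h2 h
  rw [h2, h]

theorem norm_one_sub_conj_mul_self {z : ℂ} (hz : ‖z‖ < 1) :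
    ‖1 - conj z * z‖ = 1 - ‖z‖ ^ 2 := by
  rw [← Complex.normSq_eq_conj_mul_self, Complex.normSq_eq_norm_sq, ← Complex.ofReal_one,
    ← Complex.ofReal_sub, Complex.norm_real, Real.norm_of_nonneg (one_sub_norm_sq_pos hz).le]

theorem continuous_log_poissonDensity {z : ℂ} (hz : ‖z‖ < 1) :
    Continuous fun ζ => Real.log (poissonDensity z ζ) :=
  (continuous_poissonDensity hz).log fun ζ => (poissonDensity_pos hz ζ).ne'

/-- On the circle `‖ζ - z‖ = ‖1 - conj z * ζ‖`, and `1 - conj z * w` has no zero in the closed disk,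
so its log-modulus averages to `log (1 - ‖z‖²)`. -/
theorem integral_log_poissonDensity {z : ℂ} (hz : ‖z‖ < 1) :
    ∫ ζ, Real.log (poissonDensity z ζ) ∂harmonicMeasure z = -Real.log (1 - ‖z‖ ^ 2) := by
  have := isProbabilityMeasure_harmonicMeasure hz
  have h := integral_log_norm_harmonicMeasure hz (g := fun w => 1 - conj z * w)
    (Differentiable.diffContOnCl (by fun_prop))
    fun w hw => re_one_sub_conj_mul_pos hz (mem_closedBall_zero_iff.1 hw)
  simp only [norm_one_sub_conj_mul_circle, norm_one_sub_conj_mul_self hz] at h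
  have e : ∀ ζ : Circle, Real.log (poissonDensity z ζ) =
      Real.log (1 - ‖z‖ ^ 2) - 2 * Real.log ‖(ζ : ℂ) - z‖ := fun ζ => by
    rw [poissonDensity, Real.log_div (one_sub_norm_sq_pos hz).ne'
      (pow_pos (norm_circle_sub_pos hz ζ) 2).ne', Real.log_pow]
    norm_num
  have hc : Continuous fun ζ : Circle => Real.log ‖(ζ : ℂ) - z‖ :=
    Continuous.log (by fun_prop) fun ζ => (norm_circle_sub_pos hz ζ).ne'
  simp_rw [e]
  rw [integral_sub (integrable_const _)
    ((integrable_harmonicMeasure_of_continuous hz hc).const_mul 2), integral_const_mul, h]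
  simp
  ring

theorem re_herglotz_eq_poissonDensity (z : ℂ) (ζ : Circle) :
    (((ζ : ℂ) + z) / ((ζ : ℂ) - z)).re = poissonDensity z ζ := by
  have h := congrFun (poissonKernel_eq_re_herglotzRieszKernel (c := 0) (w := z)) ζ
  rw [Function.comp_apply, poissonKernel_def, herglotzRieszKernel_def] at h
  simp only [sub_zero] at h
  rw [← h, Circle.norm_coe, one_pow, poissonDensity]

theorem norm_outerFunction {z : ℂ} (hz : ‖z‖ < 1) {h : Circle → ℝ}
    (hh : Integrable (fun ζ => Real.log (h ζ)) circleMeasure) :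
    ‖outerFunction h z‖ = Real.exp (∫ ζ, Real.log (h ζ) ∂harmonicMeasure z) := by
  have hc : Continuous fun ζ : Circle => ((ζ : ℂ) + z) / ((ζ : ℂ) - z) :=
    Continuous.div (by fun_prop) (by fun_prop) fun ζ =>
      norm_pos_iff.1 (norm_circle_sub_pos hz ζ)
  obtain ⟨C, hC⟩ := (isCompact_range hc).isBounded.exists_norm_le
  have hi : Integrable (fun ζ : Circle => (((ζ : ℂ) + z) / ((ζ : ℂ) - z)) *
      ((Real.log (h ζ) : ℝ) : ℂ)) circleMeasure :=
    hh.ofReal.bdd_mul hc.aestronglyMeasurable (.of_forall fun ζ => hC _ (mem_range_self ζ))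
  rw [outerFunction, Complex.norm_exp, integral_harmonicMeasure hz]
  congr 1
  have h2 := Complex.reCLM.integral_comp_comm hi
  simp only [Complex.reCLM_apply] at h2
  rw [← h2]
  congr 1 with ζ
  rw [Complex.re_mul_ofReal, re_herglotz_eq_poissonDensity, smul_eq_mul]

/-! ### Jensen's inequality and the radial limit of the Poisson formula. -/

/-- A form of Jensen's inequality for the logarithm on a set of finite measure. -/
theorem setIntegral_log_le {X : Type*} [MeasurableSpace X] {μ : Measure X} [IsFiniteMeasure μ]
    {S : Set X} {f : X → ℝ} {B : ℝ} (hf : ∀ x, 0 < f x) (hfi : IntegrableOn f S μ)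
    (hli : IntegrableOn (fun x => Real.log (f x)) S μ) (hB : 0 < B) (hle : ∫ x in S, f x ∂μ ≤ B) :
    ∫ x in S, Real.log (f x) ∂μ ≤ μ.real S * Real.log (B / μ.real S) := by
  rcases (measureReal_nonneg (μ := μ) (s := S)).eq_or_lt with h0 | hq
  · have : μ S = 0 := (measureReal_eq_zero_iff).1 h0.symm
    rw [setIntegral_measure_zero _ this, ← h0, zero_mul]
  have hm : 0 < B / μ.real S := div_pos hB hq
  -- Tangent line of `log` at `B / μ.real S`; its linear part integrates to at most `μ.real S`,
  -- cancelling the `-1`.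
  have hpt : ∀ x, Real.log (f x) ≤ Real.log (B / μ.real S) - 1 + (B / μ.real S)⁻¹ * f x :=
    fun x => by
      have h := Real.log_le_sub_one_of_pos (div_pos (hf x) hm)
      rw [Real.log_div (hf x).ne' hm.ne', div_eq_inv_mul (f x)] at h
      linarith
  have h := integral_mono hli ((integrable_const _).add (hfi.const_mul _)) hpt
  rw [integral_add' (integrable_const _) (hfi.const_mul _), integral_const_mul, integral_const,
    measureReal_restrict_apply_univ, smul_eq_mul] at h
  have h2 := mul_le_mul_of_nonneg_left hle (inv_pos.2 hm).le
  have h3 : (B / μ.real S)⁻¹ * B = μ.real S := by field_simp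
  linarith

/-- The bound is affine in `b`, so its Poisson average is its value at the centre. -/
theorem norm_one_sub_conj_mul_sq_le {a b : ℂ} (hb : ‖b‖ ≤ 1) :
    ‖1 - conj a * b‖ ^ 2 ≤ 1 - 2 * (conj a * b).re + ‖a‖ ^ 2 := by
  have h1 : ‖1 - conj a * b‖ ^ 2 = 1 - 2 * (conj a * b).re + ‖conj a * b‖ ^ 2 := by
    simp only [← Complex.normSq_eq_norm_sq, Complex.normSq_apply, Complex.sub_re, Complex.sub_im,
      Complex.one_re, Complex.one_im]
    ring
  rw [h1, norm_mul, RCLike.norm_conj]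
  have : ‖a‖ * ‖b‖ ≤ ‖a‖ := mul_le_of_le_one_right (norm_nonneg _) hb
  have := pow_le_pow_left₀ (by positivity) this 2
  linarith

/-- Uniform in `b`: the dominating constant for the limit `r → 1`. -/
theorem abs_log_norm_one_sub_conj_mul_le {a b : ℂ} (ha : ‖a‖ < 1) (hb : ‖b‖ ≤ 1) :
    |Real.log ‖1 - conj a * b‖| ≤ |Real.log (1 - ‖a‖)| + Real.log 2 := by
  have h0 := norm_pos_iff.2 (one_sub_conj_mul_ne_zero ha hb)
  have h1 : ‖conj a * b‖ ≤ ‖a‖ := by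
    rw [norm_mul, RCLike.norm_conj]
    exact mul_le_of_le_one_right (norm_nonneg _) hb
  have h2 := norm_sub_norm_le 1 (conj a * b)
  have h3 := norm_sub_le 1 (conj a * b)
  rw [norm_one] at h2 h3
  have h4 := Real.log_le_log h0 (by linarith : ‖1 - conj a * b‖ ≤ 2)
  have h5 := Real.log_le_log (by linarith) (by linarith : 1 - ‖a‖ ≤ ‖1 - conj a * b‖)
  have h6 := Real.log_pos one_lt_two
  rw [abs_le]
  constructor <;> linarith [neg_abs_le (Real.log (1 - ‖a‖)), abs_nonneg (Real.log (1 - ‖a‖))]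

theorem diffContOnCl_comp_radius {φ : ℂ → ℂ} (hφ : DifferentiableOn ℂ φ (ball 0 1)) {r : ℝ}
    (hr : r ∈ Ioo (0 : ℝ) 1) : DiffContOnCl ℂ (fun w => φ (r * w)) (ball 0 1) := by
  refine (DifferentiableOn.mono ?_ closure_ball_subset_closedBall).diffContOnCl
  refine hφ.comp (by fun_prop) fun w hw => ?_
  rw [mem_closedBall_zero_iff] at hw
  rw [mem_ball_zero_iff, norm_mul, Complex.norm_real, Real.norm_of_nonneg hr.1.le]
  nlinarith [hr.1, hr.2, norm_nonneg w]

/-- The Poisson formula for `log |1 - conj a * f|`, with Jensen's inequality applied to the part of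
the integral outside `E`. -/
theorem two_mul_log_norm_one_sub_conj_mul_le {f : ℂ → ℂ} (hf : DiffContOnCl ℂ f (ball 0 1))
    (hf1 : ∀ w ∈ closedBall (0 : ℂ) 1, ‖f w‖ ≤ 1) {a z : ℂ} (ha : ‖a‖ < 1) (hz : ‖z‖ < 1)
    {E : Set Circle} (hE : NullMeasurableSet E (harmonicMeasure z)) :
    2 * Real.log ‖1 - conj a * f z‖ ≤
      2 * ∫ ζ : Circle in E, Real.log ‖1 - conj a * f ζ‖ ∂harmonicMeasure z +
        (harmonicMeasure z).real Eᶜ *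
          Real.log ((1 - 2 * (conj a * f z).re + ‖a‖ ^ 2) / (harmonicMeasure z).real Eᶜ) := by
  have := isProbabilityMeasure_harmonicMeasure hz
  have hfc := hf.continuous_comp_circle
  have hζ1 : ∀ ζ : Circle, ‖f ζ‖ ≤ 1 := fun ζ =>
    hf1 ζ (mem_closedBall_zero_iff.2 (Circle.norm_coe ζ).le)
  have hz1 : ‖f z‖ ≤ 1 := hf1 z (mem_closedBall_zero_iff.2 hz.le)
  have hmulc : Continuous fun ζ : Circle => conj a * f ζ := continuous_const.mul hfc
  have hnc : Continuous fun ζ : Circle => ‖1 - conj a * f ζ‖ := (continuous_const.sub hmulc).norm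
  have hne : ∀ ζ : Circle, 0 < ‖1 - conj a * f ζ‖ := fun ζ =>
    norm_pos_iff.2 (one_sub_conj_mul_ne_zero ha (hζ1 ζ))
  have hlogi : Integrable (fun ζ : Circle => Real.log ‖1 - conj a * f ζ‖) (harmonicMeasure z) :=
    integrable_harmonicMeasure_of_continuous hz (hnc.log fun ζ => (hne ζ).ne')
  have hP := integral_log_norm_harmonicMeasure hz (g := fun w => 1 - conj a * f w)
    ((hf.const_smul (conj a)).const_sub 1)
    fun w hw => re_one_sub_conj_mul_pos ha (hf1 w hw)
  rw [← hP, ← integral_add_compl₀ hE hlogi, mul_add]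
  refine add_le_add le_rfl ?_
  have hsqi : Integrable (fun ζ : Circle => ‖1 - conj a * f ζ‖ ^ 2) (harmonicMeasure z) :=
    integrable_harmonicMeasure_of_continuous hz (hnc.pow 2)
  have hlog2 : ∀ ζ : Circle, Real.log (‖1 - conj a * f ζ‖ ^ 2) =
      2 * Real.log ‖1 - conj a * f ζ‖ := fun ζ => by
    rw [Real.log_pow]; norm_num
  have hB : 0 < 1 - 2 * (conj a * f z).re + ‖a‖ ^ 2 :=
    (pow_pos (norm_pos_iff.2 (one_sub_conj_mul_ne_zero ha hz1)) 2).trans_le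
      (norm_one_sub_conj_mul_sq_le hz1)
  have hint : ∫ ζ : Circle, (conj a * f ζ).re ∂harmonicMeasure z = (conj a * f z).re := by
    have h1 := integral_harmonicMeasure_of_diffContOnCl hz (hf.const_smul (conj a))
    have h2 := Complex.reCLM.integral_comp_comm
      (integrable_harmonicMeasure_of_continuous hz hmulc)
    simp only [Complex.reCLM_apply] at h2
    rw [h2]
    exact congrArg Complex.re h1
  have hrei : Integrable (fun ζ : Circle => (conj a * f ζ).re) (harmonicMeasure z) :=
    integrable_harmonicMeasure_of_continuous hz (Complex.continuous_re.comp hmulc)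
  have hle : ∫ ζ : Circle in Eᶜ, ‖1 - conj a * f ζ‖ ^ 2 ∂harmonicMeasure z ≤
      1 - 2 * (conj a * f z).re + ‖a‖ ^ 2 := by
    refine (setIntegral_le_integral hsqi (.of_forall fun ζ => by positivity)).trans ?_
    have h3 := integral_mono hsqi
      (((integrable_const (1 : ℝ)).sub (hrei.const_mul 2)).add (integrable_const (‖a‖ ^ 2)))
      fun ζ => norm_one_sub_conj_mul_sq_le (hζ1 ζ)
    refine h3.trans_eq ?_
    rw [integral_add' ((integrable_const (1 : ℝ)).sub (hrei.const_mul 2)) (integrable_const _),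
      integral_sub' (integrable_const (1 : ℝ)) (hrei.const_mul 2), integral_const_mul, hint]
    simp
  have hJ := setIntegral_log_le (S := Eᶜ) (fun ζ => pow_pos (hne ζ) 2) hsqi.integrableOn
    (by simp_rw [hlog2]; exact (hlogi.const_mul 2).integrableOn) hB hle
  simp_rw [hlog2] at hJ
  rwa [integral_const_mul] at hJ

/-- If `φ` maps the disk to itself and `G` is the radial limit of `log |1 - conj (φ z) φ|` on `E`,
then the Poisson formula for this function bounds its value at `z` by the contribution of `E`
and a Jensen term for the complement of `E`. -/
theorem two_mul_log_one_sub_norm_sq_le {φ : ℂ → ℂ} (hφ : DifferentiableOn ℂ φ (ball 0 1))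
    (hm : MapsTo φ (ball 0 1) (ball 0 1)) {z : ℂ} (hz : ‖z‖ < 1) {E : Set Circle}
    (hE : NullMeasurableSet E (harmonicMeasure z)) {G : Circle → ℝ}
    (hG : ∀ᵐ ζ : Circle ∂(harmonicMeasure z).restrict E, Tendsto
      (fun r : ℝ => Real.log ‖1 - conj (φ z) * φ (r * (ζ : ℂ))‖) (𝓝[<] 1) (𝓝 (G ζ))) :
    IntegrableOn G E (harmonicMeasure z) ∧
      2 * Real.log (1 - ‖φ z‖ ^ 2) ≤ 2 * ∫ ζ in E, G ζ ∂harmonicMeasure z +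
        (harmonicMeasure z).real Eᶜ *
          Real.log ((1 - ‖φ z‖ ^ 2) / (harmonicMeasure z).real Eᶜ) := by
  have := isProbabilityMeasure_harmonicMeasure hz
  set μ := harmonicMeasure z
  have ha : ‖φ z‖ < 1 := mem_ball_zero_iff.1 (hm (mem_ball_zero_iff.2 hz))
  have hIoo : ∀ᶠ r : ℝ in 𝓝[<] 1, r ∈ Ioo (0 : ℝ) 1 := Ioo_mem_nhdsLT zero_lt_one
  have hmem : ∀ r ∈ Ioo (0 : ℝ) 1, ∀ w : ℂ, ‖w‖ ≤ 1 → ‖φ (r * w)‖ < 1 := fun r hr w hw => by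
    refine mem_ball_zero_iff.1 (hm ?_)
    rw [mem_ball_zero_iff, norm_mul, Complex.norm_real, Real.norm_of_nonneg hr.1.le]
    nlinarith [hr.1, hr.2, norm_nonneg w]
  have hcirc : ∀ r ∈ Ioo (0 : ℝ) 1, ∀ ζ : Circle, ‖φ (r * ζ)‖ < 1 := fun r hr ζ =>
    hmem r hr ζ (Circle.norm_coe ζ).le
  have hcont : ∀ r ∈ Ioo (0 : ℝ) 1, Continuous fun ζ : Circle => φ (r * ζ) := fun r hr =>
    (diffContOnCl_comp_radius hφ hr).continuous_comp_circle
  have hne : ∀ r ∈ Ioo (0 : ℝ) 1, ∀ ζ : Circle, 0 < ‖1 - conj (φ z) * φ (r * ζ)‖ :=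
    fun r hr ζ => norm_pos_iff.2 (one_sub_conj_mul_ne_zero ha (hcirc r hr ζ).le)
  have hlogc : ∀ r ∈ Ioo (0 : ℝ) 1,
      Continuous fun ζ : Circle => Real.log ‖1 - conj (φ z) * φ (r * ζ)‖ := fun r hr => by
    have := hcont r hr
    exact Continuous.log (continuous_const.sub (continuous_const.mul this)).norm
      fun ζ => (hne r hr ζ).ne'
  have hbdd : ∀ᶠ r : ℝ in 𝓝[<] 1, ∀ᵐ ζ : Circle ∂μ.restrict E,
      ‖Real.log ‖1 - conj (φ z) * φ (r * ζ)‖‖ ≤ |Real.log (1 - ‖φ z‖)| + Real.log 2 := by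
    filter_upwards [hIoo] with r hr
    exact .of_forall fun ζ => abs_log_norm_one_sub_conj_mul_le ha (hcirc r hr ζ).le
  have hmeas : ∀ᶠ r : ℝ in 𝓝[<] 1, AEStronglyMeasurable
      (fun ζ : Circle => Real.log ‖1 - conj (φ z) * φ (r * ζ)‖) (μ.restrict E) := by
    filter_upwards [hIoo] with r hr
    exact (hlogc r hr).aestronglyMeasurable
  obtain ⟨u, hu⟩ := exists_seq_tendsto (𝓝[<] (1 : ℝ))
  obtain ⟨N, hN⟩ := eventually_atTop.1 (hu.eventually hIoo)
  -- Measurability of `G` needs a sequence of radii; the shift by `N` keeps all of them in `(0, 1)`.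
  have hGi : IntegrableOn G E μ := by
    have hu' := hu.comp (tendsto_add_atTop_nat N)
    have hGm : AEStronglyMeasurable G (μ.restrict E) :=
      aestronglyMeasurable_of_tendsto_ae atTop
        (f := fun n (ζ : Circle) => Real.log ‖1 - conj (φ z) * φ ((u (n + N) : ℝ) * ζ)‖)
        (fun n => (hlogc _ (hN _ (Nat.le_add_left N n))).aestronglyMeasurable)
        (hG.mono fun ζ hζ => hζ.comp hu')
    refine Integrable.of_bound hGm (|Real.log (1 - ‖φ z‖)| + Real.log 2) ?_
    filter_upwards [hG] with ζ hζ
    refine le_of_tendsto hζ.norm ?_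
    filter_upwards [hIoo] with r hr
    exact abs_log_norm_one_sub_conj_mul_le ha (hcirc r hr ζ).le
  refine ⟨hGi, ?_⟩
  have hlim : Tendsto (fun r : ℝ => ∫ ζ in E, Real.log ‖1 - conj (φ z) * φ (r * ζ)‖ ∂μ)
      (𝓝[<] 1) (𝓝 (∫ ζ in E, G ζ ∂μ)) :=
    tendsto_integral_filter_of_dominated_convergence _ hmeas hbdd (integrable_const _) hG
  have hφr : Tendsto (fun r : ℝ => φ (r * z)) (𝓝[<] 1) (𝓝 (φ z)) := by
    have h1 : ContinuousAt φ z :=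
      (hφ.differentiableAt (isOpen_ball.mem_nhds (mem_ball_zero_iff.2 hz))).continuousAt
    have h2 := (by fun_prop : Continuous fun r : ℝ => (r : ℂ) * z).tendsto 1
    rw [Complex.ofReal_one, one_mul] at h2
    exact h1.tendsto.comp (h2.mono_left nhdsWithin_le_nhds)
  have key : ∀ᶠ r : ℝ in 𝓝[<] 1, 2 * Real.log ‖1 - conj (φ z) * φ (r * z)‖ ≤
      2 * ∫ ζ in E, Real.log ‖1 - conj (φ z) * φ (r * ζ)‖ ∂μ +
        μ.real Eᶜ * Real.log ((1 - 2 * (conj (φ z) * φ (r * z)).re + ‖φ z‖ ^ 2) / μ.real Eᶜ) := by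
    filter_upwards [hIoo] with r hr
    exact two_mul_log_norm_one_sub_conj_mul_le (diffContOnCl_comp_radius hφ hr)
      (fun w hw => (hmem r hr w (mem_closedBall_zero_iff.1 hw)).le) ha hz hE
  have hself : (conj (φ z) * φ z).re = ‖φ z‖ ^ 2 := by
    rw [← Complex.normSq_eq_conj_mul_self, Complex.ofReal_re, Complex.normSq_eq_norm_sq]
  have hpos := one_sub_norm_sq_pos ha
  have hL : Tendsto (fun r : ℝ => 2 * Real.log ‖1 - conj (φ z) * φ (r * z)‖) (𝓝[<] 1)
      (𝓝 (2 * Real.log (1 - ‖φ z‖ ^ 2))) := by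
    rw [← norm_one_sub_conj_mul_self ha]
    exact (((hφr.const_mul _).const_sub 1).norm.log
      (norm_pos_iff.2 (one_sub_conj_mul_ne_zero ha ha.le)).ne').const_mul 2
  have hBt : Tendsto (fun r : ℝ => 1 - 2 * (conj (φ z) * φ (r * z)).re + ‖φ z‖ ^ 2) (𝓝[<] 1)
      (𝓝 (1 - ‖φ z‖ ^ 2)) := by
    have h := ((((Complex.continuous_re.tendsto _).comp
      (hφr.const_mul (conj (φ z)))).const_mul 2).const_sub 1).add_const (‖φ z‖ ^ 2)
    rwa [hself, show 1 - 2 * ‖φ z‖ ^ 2 + ‖φ z‖ ^ 2 = 1 - ‖φ z‖ ^ 2 by ring] at h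
  refine le_of_tendsto_of_tendsto hL ((hlim.const_mul 2).add ?_) key
  -- If `Eᶜ` is null, the Jensen term is identically `0`; otherwise it is continuous in `r` at the
  -- limit.
  rcases (measureReal_nonneg (μ := μ) (s := Eᶜ)).eq_or_lt with h0 | hq
  · simp only [← h0, zero_mul]
    exact tendsto_const_nhds
  · exact ((hBt.div_const _).log (div_pos hpos hq).ne').const_mul _

/-! ### Julia's inequality in logarithmic form and the final estimate. -/

theorem log_poissonDensity_add_le {φ : ℂ → ℂ} (hφ : DifferentiableOn ℂ φ (ball 0 1))
    (hm : MapsTo φ (ball 0 1) (ball 0 1)) {ζ : Circle} {η d : ℂ} (hη1 : ‖η‖ = 1)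
    (hη : HasNontangentialLimit φ ζ η) (hd : HasNontangentialLimit (deriv φ) ζ d)
    {z : ℂ} (hz : ‖z‖ < 1) :
    Real.log (poissonDensity z ζ) + 2 * Real.log ‖1 - conj (φ z) * η‖ ≤
      Real.log (1 - ‖φ z‖ ^ 2) + Real.log ‖d‖ := by
  have ha : ‖φ z‖ < 1 := mem_ball_zero_iff.1 (hm (mem_ball_zero_iff.2 hz))
  have hX := norm_pos_iff.2 (one_sub_conj_mul_ne_zero ha hη1.le)
  have hP := poissonDensity_pos hz ζ
  have h := julia_inequality hφ hm hη1 hη hd hz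
  rw [← div_le_iff₀ (pow_pos (norm_circle_sub_pos hz ζ) 2), mul_div_right_comm] at h
  change poissonDensity z ζ * _ ≤ _ at h
  have hL : 0 < poissonDensity z ζ * ‖1 - conj (φ z) * η‖ ^ 2 := by positivity
  -- Julia's inequality has a positive left side, so an angular derivative never vanishes and `log
  -- ‖d‖` is no default value.
  have hd0 : ‖d‖ ≠ 0 := fun h0 => by
    rw [h0, mul_zero] at h
    linarith
  have h2 := Real.log_le_log hL h
  rw [Real.log_mul hP.ne' (by positivity), Real.log_mul (one_sub_norm_sq_pos ha).ne' hd0,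
    Real.log_pow] at h2
  exact_mod_cast h2

end

theorem theorem1 (φ : ℂ → ℂ)
    (hφ : DifferentiableOn ℂ φ (Metric.ball (0 : ℂ) 1))
    (hnorm : IsLUB ((fun z : ℂ => ‖φ z‖) '' Metric.ball (0 : ℂ) 1) 1)
    (hnonconst : ¬ ∃ c : ℂ, ∀ z ∈ Metric.ball (0 : ℂ) 1, φ z = c)
    (E : Set Circle) (hE : NullMeasurableSet E circleMeasure)
    (hang : ∀ᵐ ζ ∂circleMeasure, ζ ∈ E → ∃ d : ℂ, HasAngularDerivAt φ ζ d)
    (hlog : IntegrableOn (fun ζ : Circle => Real.log ‖angularDeriv φ ζ‖) E circleMeasure)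
    (z : ℂ) (hz : z ∈ Metric.ball (0 : ℂ) 1) :
    (1 - ‖φ z‖ ^ 2) / (1 - ‖z‖ ^ 2) ≤
      ‖outerFunction
          (fun ζ : Circle => E.indicator (fun ξ : Circle => ‖angularDeriv φ ξ‖) ζ
            + Eᶜ.indicator (fun _ : Circle => (1 : ℝ)) ζ) z‖ *
        (1 / (1 - (harmonicMeasure z).real E) * ((1 + ‖z‖) / (1 - ‖z‖))) ^
          (1 - (harmonicMeasure z).real E) := by
  have hm : MapsTo φ (Metric.ball 0 1) (Metric.ball 0 1) :=
    norm_lt_one_of_isLUB hφ (fun w hw => hnorm.1 (mem_image_of_mem _ hw)) hnonconst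
  have ha : ‖φ z‖ < 1 := mem_ball_zero_iff.1 (hm hz)
  have hz1 : ‖z‖ < 1 := mem_ball_zero_iff.1 hz
  have hprob := isProbabilityMeasure_harmonicMeasure hz1
  have hac := harmonicMeasure_absolutelyContinuous z
  have hEμ : NullMeasurableSet E (harmonicMeasure z) := hE.mono_ac hac
  have hlogh : (fun ζ : Circle => Real.log (E.indicator (fun ξ : Circle => ‖angularDeriv φ ξ‖) ζ
      + Eᶜ.indicator (fun _ : Circle => (1 : ℝ)) ζ)) =
      E.indicator fun ζ => Real.log ‖angularDeriv φ ζ‖ := by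
    ext ζ
    by_cases h : ζ ∈ E <;> simp [h]
  have hind : Integrable (E.indicator fun ζ => Real.log ‖angularDeriv φ ζ‖) circleMeasure :=
    hlog.integrable_indicator₀ hE
  have hlogμ : IntegrableOn (fun ζ => Real.log ‖angularDeriv φ ζ‖) E (harmonicMeasure z) :=
    (integrable_harmonicMeasure hz1 hind).integrableOn.congr <| by
      filter_upwards [ae_restrict_mem₀ hEμ] with ζ hζ using indicator_of_mem hζ _
  rw [norm_outerFunction hz1 (by rw [hlogh]; exact hind), hlogh, integral_indicator₀ hEμ]
  have hq : (harmonicMeasure z).real Eᶜ = 1 - (harmonicMeasure z).real E :=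
    probReal_compl_eq_one_sub₀ hEμ
  rw [← hq]
  -- Boundary values of `φ`, with default `0` where there is no angular derivative; only almost
  -- every point of `E` matters.
  have hη : ∀ ζ : Circle, ∃ η : ℂ, (∃ d, HasAngularDerivAt φ ζ d) →
      ‖η‖ = 1 ∧ HasNontangentialLimit φ ζ η := fun ζ => by
    by_cases h : ∃ d, HasAngularDerivAt φ ζ d
    · obtain ⟨d, ⟨η, h1⟩, -⟩ := h
      exact ⟨η, fun _ => h1⟩
    · exact ⟨0, fun h' => absurd h' h⟩
  choose η hη using hη
  have hangE : ∀ᵐ ζ ∂(harmonicMeasure z).restrict E, ∃ d : ℂ, HasAngularDerivAt φ ζ d :=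
    (ae_restrict_iff'₀ hEμ).2 (hac.ae_le hang)
  obtain ⟨hGi, hmain⟩ := two_mul_log_one_sub_norm_sq_le hφ hm hz1 hEμ
    (G := fun ζ => Real.log ‖1 - starRingEnd ℂ (φ z) * η ζ‖) (by
      filter_upwards [hangE] with ζ hζ
      obtain ⟨h1, h2⟩ := hη ζ hζ
      exact ((h2.tendsto_radius.const_mul _).const_sub 1).norm.log
        (norm_pos_iff.2 (one_sub_conj_mul_ne_zero ha h1.le)).ne')
  have hPi := integrable_harmonicMeasure_of_continuous hz1 (continuous_log_poissonDensity hz1)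
  have hjulia : ∀ᵐ ζ ∂(harmonicMeasure z).restrict E,
      Real.log (poissonDensity z ζ) + 2 * Real.log ‖1 - starRingEnd ℂ (φ z) * η ζ‖ ≤
        Real.log (1 - ‖φ z‖ ^ 2) + Real.log ‖angularDeriv φ ζ‖ := by
    filter_upwards [hangE] with ζ hζ
    obtain ⟨h1, h2⟩ := hη ζ hζ
    have h3 : HasAngularDerivAt φ ζ (angularDeriv φ ζ) := by
      rw [angularDeriv, dif_pos hζ]
      exact hζ.choose_spec
    exact log_poissonDensity_add_le hφ hm h1 h2 h3.2 hz1
  have hI := integral_mono_ae (hPi.integrableOn.add (hGi.const_mul 2))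
    ((integrable_const _).add hlogμ) hjulia
  rw [integral_add' hPi.integrableOn (hGi.const_mul 2), integral_add' (integrable_const _) hlogμ,
    integral_const_mul, integral_const, measureReal_restrict_apply_univ, smul_eq_mul] at hI
  -- Trades `∫_E log P` for `∫_Eᶜ log P`, which has an upper bound from the maximum of `P`.
  have hsplit := integral_add_compl₀ hEμ hPi
  rw [integral_log_poissonDensity hz1] at hsplit
  have hcompl : ∫ ζ in Eᶜ, Real.log (poissonDensity z ζ) ∂harmonicMeasure z ≤
      (harmonicMeasure z).real Eᶜ * Real.log ((1 + ‖z‖) / (1 - ‖z‖)) := by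
    have h := integral_mono (hPi.integrableOn (s := Eᶜ)) (integrable_const _) fun ζ =>
      Real.log_le_log (poissonDensity_pos hz1 ζ) (poissonDensity_le hz1 ζ)
    rwa [integral_const, measureReal_restrict_apply_univ, smul_eq_mul] at h
  have hA := one_sub_norm_sq_pos ha
  have hZ := one_sub_norm_sq_pos hz1
  have hK : 0 < (1 + ‖z‖) / (1 - ‖z‖) := div_pos (by positivity) (by linarith)
  have hω : (harmonicMeasure z).real E = 1 - (harmonicMeasure z).real Eᶜ := by linarith
  rw [hω] at hI
  set q := (harmonicMeasure z).real Eᶜ with hqdef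
  -- For `q = 0` the factor is a power with exponent `0`, hence `1` whatever the value of `1 / 0`.
  rcases (measureReal_nonneg : 0 ≤ (harmonicMeasure z).real Eᶜ).eq_or_lt with h0 | h0
  · rw [← hqdef] at h0
    rw [← h0, Real.rpow_zero, mul_one, ← Real.log_le_iff_le_exp (div_pos hA hZ),
      Real.log_div hA.ne' hZ.ne']
    simp only [← h0, zero_mul, sub_zero, one_mul, add_zero] at hI hmain hcompl
    linarith
  · rw [← hqdef] at h0
    rw [Real.rpow_def_of_pos (by positivity), ← Real.exp_add,
      ← Real.log_le_iff_le_exp (div_pos hA hZ), Real.log_div hA.ne' hZ.ne',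
      Real.log_mul (by positivity) hK.ne', Real.log_div one_ne_zero h0.ne', Real.log_one]
    rw [Real.log_div hA.ne' h0.ne'] at hmain
    linarith
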